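/- Let $(R,\mathfrak m)$ be a commutative noetherian local ring. For a finitely generated $R$-module $L$ write $h^i(L)$ for the length of the local cohomology module $H^i_{\mathfrak m}(L)$, provided it is finite, $\beta_i(L)$ for the rank of the $i$-th free module in the minimal free resolution of $L$, and $\operatorname{pd}(L)$ for the projective dimension of $L$. Assume that $R$ is equidimensional ($\dim R/\mathfrak p=\dim R$ for every minimal prime $\mathfrak p$) and generalized Cohen–Macaulay ($H^i_{\mathfrak m}(R)$ has finite length for all $i<\dim R$). Let $M$ and $N$ be finitely generated $R$-modules such that $N$ is locally free of constant rank over the punctured spectrum, i.e. there is an integer $r\ge 0$ with $N_{\mathfrak p}$ free of rank $r$ over $R_{\mathfrak p}$ for every prime $\mathfrak p\neq\mathfrak m$. If $\operatorname{pd}(M)<\operatorname{depth}(R)$, then $h^0(M\otimes_R N)$ and all $h^i(N)$ with $0\le i\le\operatorname{pd}(M)$ are finite, and $$h^0(M\otimes_R N)\le\sum_{i=0}^{\operatorname{pd}(M)}\beta_i(M)\,h^i(N).$$ (For $M=0$ both sides of the inequality are $0$.) -/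

import Mathlib

open scoped TensorProduct

universe u

section LocalAlgebra

variable (R : Type u) [CommRing R] [IsLocalRing R]

/-- The depth of a local ring: the supremum of the lengths of the `R`-regular sequences contained
in the maximal ideal. -/
noncomputable def localDepth : ℕ∞ :=
  ⨆ (rs : List R) (_ : RingTheory.Sequence.IsRegular R rs ∧
    ∀ r ∈ rs, r ∈ IsLocalRing.maximalIdeal R), (rs.length : ℕ∞)

/-- `R` is equidimensional: `dim R/p = dim R` for every minimal prime `p` of `R`. -/
def IsEquidimensional : Prop :=
  ∀ p ∈ minimalPrimes R, ringKrullDim (R ⧸ p) = ringKrullDim R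

/-- `hLength R i M` is the length of the `i`-th local cohomology module of `M` with support in
the maximal ideal of `R`; the value is `⊤` if that length is not finite. -/
noncomputable def hLength (i : ℕ) (M : Type u) [AddCommGroup M] [Module R M] : ℕ∞ :=
  Module.length R
    ((localCohomology (IsLocalRing.maximalIdeal R) i).obj (ModuleCat.of R M))

/-- `R` is generalized Cohen-Macaulay: its local cohomology modules with support in the maximal
ideal have finite length in all degrees `i < dim R`. -/
def IsGeneralizedCohenMacaulay : Prop :=
  ∀ i : ℕ, (i : WithBot ℕ∞) < ringKrullDim R → hLength R i R ≠ ⊤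

/-- `N` is locally free of constant rank over the punctured spectrum of `R`. -/
def IsLocallyFreeOfConstantRankOnPunctured (N : Type u) [AddCommGroup N] [Module R N] : Prop :=
  ∃ r : ℕ, ∀ p : PrimeSpectrum R, p.asIdeal ≠ IsLocalRing.maximalIdeal R →
    Module.Free (Localization.AtPrime p.asIdeal) (LocalizedModule p.asIdeal.primeCompl N) ∧
    Module.finrank (Localization.AtPrime p.asIdeal)
      (LocalizedModule p.asIdeal.primeCompl N) = r

/-- A minimal free resolution
`⋯ ⟶ R ^ rank 2 ⟶ R ^ rank 1 ⟶ R ^ rank 0 ⟶ M ⟶ 0` by free modules of finite rank. -/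
structure MinimalFreeResolution (M : Type u) [AddCommGroup M] [Module R M] where
  rank : ℕ → ℕ
  d : ∀ i : ℕ, (Fin (rank (i + 1)) → R) →ₗ[R] (Fin (rank i) → R)
  aug : (Fin (rank 0) → R) →ₗ[R] M
  aug_surjective : Function.Surjective aug
  exact_zero : Function.Exact (d 0) aug
  exact_succ : ∀ i : ℕ, Function.Exact (d (i + 1)) (d i)
  minimal : ∀ i : ℕ, LinearMap.range (d i) ≤
    IsLocalRing.maximalIdeal R • (⊤ : Submodule R (Fin (rank i) → R))

theorem exists_minimal_cover (M : Type u) [AddCommGroup M] [Module R M] [Module.Finite R M] :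
    ∃ (n : ℕ) (f : (Fin n → R) →ₗ[R] M), Function.Surjective f ∧
      LinearMap.ker f ≤ IsLocalRing.maximalIdeal R • (⊤ : Submodule R (Fin n → R)) := by
  let k := IsLocalRing.ResidueField R
  let b := Module.finBasis k (k ⊗[R] M)
  obtain ⟨v, hv⟩ := (TensorProduct.mk_surjective R M k Ideal.Quotient.mk_surjective).comp_left b
  have hv' : ∀ i, (1 : k) ⊗ₜ[R] v i = b i := fun i => congr_fun hv i
  refine ⟨_, Fintype.linearCombination R v, ?_, ?_⟩
  · rw [← LinearMap.range_eq_top, Fintype.range_linearCombination]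
    exact IsLocalRing.span_eq_top_of_tmul_eq_basis v b hv'
  · intro c hc
    have h0 : ∑ i, c i • v i = 0 := by
      simpa [Fintype.linearCombination_apply] using hc
    have h1 : ∑ i, (algebraMap R k (c i)) • b i = 0 := by
      have h := congr_arg (TensorProduct.mk R k M 1) h0
      simp only [map_sum, map_smul, map_zero, TensorProduct.mk_apply, hv'] at h
      simpa only [algebraMap_smul] using h
    have h2 : ∀ i, c i ∈ IsLocalRing.maximalIdeal R := fun i => by
      have h := Fintype.linearIndependent_iff.mp b.linearIndependent _ h1 i
      exact (IsLocalRing.residue_eq_zero_iff (c i)).mp h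
    rw [pi_eq_sum_univ' c]
    exact Submodule.sum_mem _ fun i _ =>
      Submodule.smul_mem_smul (h2 i) Submodule.mem_top

variable [IsNoetherianRing R]

/-- Finitely generated modules over noetherian local rings have minimal free resolutions. -/
theorem MinimalFreeResolution.nonempty (M : Type u) [AddCommGroup M] [Module R M]
    [Module.Finite R M] : Nonempty (MinimalFreeResolution R M) := by
  obtain ⟨n₀, f₀, hf₀, hk₀⟩ := exists_minimal_cover R M
  have step : ∀ s : (Σ n : ℕ, Submodule R (Fin n → R)),
      ∃ (n : ℕ) (f : (Fin n → R) →ₗ[R] s.2), Function.Surjective f ∧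
        LinearMap.ker f ≤ IsLocalRing.maximalIdeal R • (⊤ : Submodule R (Fin n → R)) :=
    fun s => exists_minimal_cover R s.2
  choose n f hf hk using step
  let s : ℕ → (Σ n : ℕ, Submodule R (Fin n → R)) := fun i =>
    Nat.rec ⟨n₀, LinearMap.ker f₀⟩ (fun _ t => ⟨n t, LinearMap.ker (f t)⟩) i
  let d : ∀ i : ℕ, (Fin (s (i + 1)).1 → R) →ₗ[R] (Fin (s i).1 → R) := fun i =>
    (s i).2.subtype ∘ₗ f (s i)
  have hr : ∀ i, LinearMap.range (d i) = (s i).2 := fun i => by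
    change LinearMap.range ((s i).2.subtype ∘ₗ f (s i)) = (s i).2
    rw [LinearMap.range_comp_of_range_eq_top _ (LinearMap.range_eq_top.mpr (hf (s i))),
      Submodule.range_subtype]
  have hker : ∀ i, LinearMap.ker (d i) = (s (i + 1)).2 := fun i => by
    change LinearMap.ker ((s i).2.subtype ∘ₗ f (s i)) = LinearMap.ker (f (s i))
    rw [LinearMap.ker_comp_of_ker_eq_bot _ (Submodule.ker_subtype _)]
  refine ⟨⟨fun i => (s i).1, d, f₀, hf₀, ?_, fun i => ?_, fun i => ?_⟩⟩
  · rw [LinearMap.exact_iff]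
    exact (hr 0).symm
  · rw [LinearMap.exact_iff, hker i, hr (i + 1)]
  · rw [hr i]
    cases i with
    | zero => exact hk₀
    | succ i => exact hk (s i)

/-- The `i`-th Betti number of a finitely generated module `M`: the rank of the `i`-th free module
in the minimal free resolution of `M` (which is unique up to isomorphism). -/
noncomputable def bettiNumber (i : ℕ) (M : Type u) [AddCommGroup M] [Module R M]
    [Module.Finite R M] : ℕ :=
  (Classical.choice (MinimalFreeResolution.nonempty R M)).rank i

end LocalAlgebra

/-! Local cohomology is the direct limit of `Ext(R/𝔪^t, -)`, and direct limits are exact, so each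
short exact sequence bounds the length `h^i` of one term by the sum over its two neighbours in the
long exact sequence. Besides this the argument needs three facts. Modules killed by a power of `𝔪`
have no cohomology in positive degrees (`hLength_succ_eq_zero_of_pow_smul_eq_bot`, by Artin–Rees);
`H^0` of a finitely generated module has finite length (`hLength_zero_ne_top`); and `H^n(R) = 0`
below the depth (`hLength_eq_zero_of_lt_localDepth`).

Local freeness of `N` enters through `PowFactorsThroughFree`: for `f ∈ 𝔪`, some `f^c`, as an
endomorphism of `N`, factors through a finite free module. Taking the finitely many generators of
`𝔪` together yields a map from `N` to a free module `F` whose kernel is killed by a power of `𝔪` and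
whose cokernel inherits the property. Since `H^{n+1}(F) = 0` below the depth, `h^{n+1}(N)` is at
most `h^n` of the cokernel, and induction gives finiteness (`hLength_ne_top_of_lt_localDepth`).

For the inequality, take `0 → K → R^b → M → 0`. The kernel of `K ⊗ N → R^b ⊗ N` is again killed by a
power of `𝔪`: after multiplication by `f^c` the map is controlled by tensoring with a free module,
which preserves injectivity. Hence `h^n(M ⊗ N) ≤ b h^n(N) + h^{n+1}(K ⊗ N)` (`hLength_tensor_le`).
Iterating along the minimal resolution produces the Betti sum, and the process ends without
remainder once the syzygy is projective (`hLength_tensor_le_sum`). -/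

namespace CategoryTheory

open Opposite Limits

universe v w

/-! ### Naturality of derived-functor Ext in terms of projective resolutions -/

section ExtResolution

variable {R : Type*} [CommRing R] {C : Type*} [Category C] [Abelian C] [Linear R C]
  [EnoughProjectives C]

/-- The map of cochain complexes `Hom(Q, Y) ⟶ Hom(P, Y)` induced by a chain map `P ⟶ Q`. -/
noncomputable def linearYonedaMap (R : Type*) [CommRing R] [Linear R C]
    {P Q : ChainComplex C ℕ} (φ : P ⟶ Q) (Y : C) :
    Q.linearYonedaObj R Y ⟶ P.linearYonedaObj R Y :=
  (HomologicalComplex.unopFunctor _ _).map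
    (((((linearYoneda R C).obj Y).rightOp.mapHomologicalComplex _).map φ).op)

lemma homologyUnop_hom_naturality {V : Type*} [Category V] [Abelian V] {ι : Type*}
    {c : ComplexShape ι} {K L : HomologicalComplex Vᵒᵖ c} (φ : K ⟶ L) (i : ι) :
    HomologicalComplex.homologyMap ((HomologicalComplex.unopFunctor _ _).map φ.op) i ≫
      (K.homologyUnop i).hom =
    (L.homologyUnop i).hom ≫ (HomologicalComplex.homologyMap φ i).unop := by
  apply Quiver.Hom.op_inj
  have h := HomologicalComplex.homologyOp_hom_naturality
    ((HomologicalComplex.unopFunctor _ _).map φ.op) i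
  exact h.symm

lemma comp_iso_symm_eq {D : Type*} [Category D] {A A' B B' E E' : D} {a : A ⟶ A'} {e' : A' ⟶ B'}
    {e : A ⟶ B} {b : B ⟶ B'} {u : E ≅ B} {u' : E' ≅ B'} {m : E ⟶ E'}
    (h : a ≫ e' = e ≫ b) (h' : m ≫ u'.hom = u.hom ≫ b) :
    a ≫ e' ≫ u'.inv = (e ≫ u.inv) ≫ m := by
  rw [← cancel_mono u'.hom]
  simp [h, h']

/-- Local cohomology is a colimit over the first argument of Ext, so the identification with
cohomology of a resolution must respect the transition maps, not merely hold objectwise. -/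
lemma isoExt_hom_naturality {X X' : C} (f : X ⟶ X') {P : ProjectiveResolution X}
    {Q : ProjectiveResolution X'} (φ : ProjectiveResolution.Hom P Q f) (n : ℕ) (Y : C) :
    ((Ext R C n).map f.op).app Y ≫ (P.isoExt n Y).hom =
      (Q.isoExt n Y).hom ≫ HomologicalComplex.homologyMap (linearYonedaMap R φ.hom Y) n := by
  have h := ProjectiveResolution.isoLeftDerivedObj_inv_naturality f P Q φ.hom
    (by simpa using φ.hom_f_zero_comp_π_f_zero) ((linearYoneda R C).obj Y).rightOp n
  have h' := homologyUnop_hom_naturality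
    ((((linearYoneda R C).obj Y).rightOp.mapHomologicalComplex _).map φ.hom) n
  have h'' : ((Ext R C n).map f.op).app Y ≫
      (P.isoLeftDerivedObj ((linearYoneda R C).obj Y).rightOp n).unop.inv =
      (Q.isoLeftDerivedObj ((linearYoneda R C).obj Y).rightOp n).unop.inv ≫
      (HomologicalComplex.homologyMap
        ((((linearYoneda R C).obj Y).rightOp.mapHomologicalComplex _).map φ.hom) n).unop :=
    congrArg Quiver.Hom.unop h
  exact comp_iso_symm_eq h'' h'

end ExtResolution

/-! ### Cycles, boundaries and homology, elementwise -/

section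

variable {R : Type v} [Ring R] (K : CochainComplex (ModuleCat.{v} R) ℕ) (n : ℕ)

lemma exists_iCycles_eq (x : K.X n) (hx : K.d n (n + 1) x = 0) :
    ∃ c : K.cycles n, K.iCycles n c = x := by
  have h := ShortComplex.exact_of_f_is_kernel
    (ShortComplex.mk (K.iCycles n) (K.d n (n + 1)) (by simp))
    (K.cyclesIsKernel n (n + 1) (by simp))
  rw [ShortComplex.moduleCat_exact_iff] at h
  exact h x hx

lemma homologyπ_eq_zero_iff (c : K.cycles n) :
    K.homologyπ n c = 0 ↔
      ∃ y : K.X ((ComplexShape.up ℕ).prev n), K.d _ n y = K.iCycles n c := by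
  have h := ShortComplex.exact_of_g_is_cokernel
    (ShortComplex.mk (K.toCycles ((ComplexShape.up ℕ).prev n) n) (K.homologyπ n) (by simp))
    (K.homologyIsCokernel _ n rfl)
  rw [ShortComplex.moduleCat_exact_iff] at h
  have hi : Function.Injective (K.iCycles n) := (ModuleCat.mono_iff_injective _).1 inferInstance
  constructor
  · intro h0
    obtain ⟨y, hy⟩ := h c h0
    refine ⟨y, ?_⟩
    rw [← hy]
    exact (ConcreteCategory.congr_hom (K.toCycles_i _ n) y).symm
  · rintro ⟨y, hy⟩
    have : K.toCycles ((ComplexShape.up ℕ).prev n) n y = c := by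
      apply hi
      rw [← hy]
      exact ConcreteCategory.congr_hom (K.toCycles_i _ n) y
    rw [← this]
    exact ConcreteCategory.congr_hom
      (K.toCycles_comp_homologyπ ((ComplexShape.up ℕ).prev n) n) y

lemma homologyπ_surjective : Function.Surjective (K.homologyπ n) :=
  (ModuleCat.epi_iff_surjective _).1 inferInstance

end

/-! ### Ext classes represented by cocycles -/

section

variable {R : Type v} [CommRing R] {C : Type*} [Category C] [Abelian C] [Linear R C] [HasExt.{v} C]
  {X Y : C} (P : ProjectiveResolution X)

namespace ProjectiveResolution

lemma smul_extMk (r : R) {n : ℕ} (f : P.complex.X n ⟶ Y) (m : ℕ) (hm : n + 1 = m)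
    (hf : P.complex.d m n ≫ f = 0) :
    r • P.extMk f m hm hf = P.extMk (r • f) m hm (by simp [hf]) := by
  rw [Abelian.Ext.smul_eq_comp_mk₀, extMk_comp_mk₀]
  congr 1
  simp

/-- The resolution lives in cohomological degrees at most 0, so its term in degree 1, from which a
coboundary would have to come, is zero. -/
lemma extMk_zero_eq_zero_iff (f : P.complex.X 0 ⟶ Y) (hf : P.complex.d 1 0 ≫ f = 0) :
    P.extMk f 1 rfl hf = 0 ↔ f = 0 := by
  simp only [← P.extEquivCohomologyClass.apply_eq_iff_eq,
    extEquivCohomologyClass_extMk, extEquivCohomologyClass_zero,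
    CochainComplex.HomComplex.CohomologyClass.mk_eq_zero_iff]
  rw [CochainComplex.HomComplex.Cocycle.toSingleMk_mem_coboundaries_iff _ _ _ _ _ 1 (by simp)]
  constructor
  · rintro ⟨g, hg⟩
    have : g = 0 := (CochainComplex.isZero_of_isStrictlyLE P.cochainComplex 0 1).eq_of_src _ _
    rw [this, comp_zero] at hg
    rw [← cancel_epi (P.cochainComplexXIso (-0) 0 rfl).hom]
    simpa using hg.symm
  · rintro rfl
    exact ⟨0, by simp⟩

end ProjectiveResolution

end

/-! ### The two constructions of Ext agree, naturally in the first variable -/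

section

variable {R : Type v} [CommRing R] {C : Type w} [Category.{v} C] [Abelian C] [Linear R C]
  {X Y : C}

namespace ProjectiveResolution

variable (P : ProjectiveResolution X) (n : ℕ)

variable (R Y) in
/-- The cocycle `P.complex.X n ⟶ Y` underlying a cycle of `Hom(P, Y)`. -/
noncomputable def cocycle : (P.complex.linearYonedaObj R Y).cycles n →ₗ[R] (P.complex.X n ⟶ Y) :=
  ((P.complex.linearYonedaObj R Y).iCycles n).hom

lemma d_comp_cocycle (c : (P.complex.linearYonedaObj R Y).cycles n) :
    P.complex.d (n + 1) n ≫ P.cocycle R Y n c = 0 :=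
  ConcreteCategory.congr_hom ((P.complex.linearYonedaObj R Y).iCycles_d n (n + 1)) c

variable [HasExt.{v} C]

variable (R Y) in
/-- The class in `Ext` of a cocycle of `Hom(P, Y)`. -/
noncomputable def cyclesToExt :
    (P.complex.linearYonedaObj R Y).cycles n →ₗ[R] Abelian.Ext X Y n where
  toFun c := P.extMk (P.cocycle R Y n c) (n + 1) rfl (P.d_comp_cocycle n c)
  map_add' c c' := by
    rw [add_extMk]
    congr 1
    exact map_add _ _ _
  map_smul' r c := by
    rw [RingHom.id_apply, smul_extMk]
    congr 1
    exact map_smul _ _ _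

lemma cyclesToExt_apply (c : (P.complex.linearYonedaObj R Y).cycles n) :
    P.cyclesToExt R Y n c = P.extMk (P.cocycle R Y n c) (n + 1) rfl (P.d_comp_cocycle n c) := rfl

lemma cyclesToExt_surjective : Function.Surjective (P.cyclesToExt R Y n) := by
  intro e
  obtain ⟨f, hf, rfl⟩ := P.extMk_surjective e (n + 1) rfl
  obtain ⟨c, hc⟩ := exists_iCycles_eq (P.complex.linearYonedaObj R Y) n f hf
  refine ⟨c, ?_⟩
  rw [cyclesToExt_apply]
  congr 1

lemma ker_cyclesToExt : LinearMap.ker (P.cyclesToExt R Y n) =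
    LinearMap.ker ((P.complex.linearYonedaObj R Y).homologyπ n).hom := by
  ext c
  refine Iff.trans ?_ (homologyπ_eq_zero_iff (P.complex.linearYonedaObj R Y) n c).symm
  cases n with
  | zero =>
    refine (P.extMk_zero_eq_zero_iff _ (P.d_comp_cocycle 0 c)).trans ?_
    -- In degree 0 there is no preceding index: `prev 0` takes the default value 0 and the
    -- differential is zero.
    have h0 : (P.complex.linearYonedaObj R Y).d ((ComplexShape.up ℕ).prev 0) 0 = 0 :=
      HomologicalComplex.shape _ _ _ (by simp)
    rw [h0]
    constructor
    · intro h
      exact ⟨0, h.symm⟩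
    · rintro ⟨y, hy⟩
      exact hy.symm
  | succ n =>
    refine (P.extMk_eq_zero_iff _ _ rfl (P.d_comp_cocycle (n + 1) c) n rfl).trans ?_
    have hp : (ComplexShape.up ℕ).prev (n + 1) = n := by simp
    rw [hp]
    rfl

variable (R Y) in
/-- The homology of `Hom(P, Y)` is `Ext`. -/
noncomputable def homologyEquivExt :
    (P.complex.linearYonedaObj R Y).homology n ≃ₗ[R] Abelian.Ext X Y n :=
  (LinearMap.quotKerEquivOfSurjective _
      (homologyπ_surjective (P.complex.linearYonedaObj R Y) n)).symm ≪≫ₗ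
    Submodule.quotEquivOfEq _ _ (P.ker_cyclesToExt n).symm ≪≫ₗ
    LinearMap.quotKerEquivOfSurjective _ (P.cyclesToExt_surjective n)

lemma homologyEquivExt_homologyπ (c : (P.complex.linearYonedaObj R Y).cycles n) :
    P.homologyEquivExt R Y n ((P.complex.linearYonedaObj R Y).homologyπ n c) =
      P.cyclesToExt R Y n c := by
  have : (LinearMap.quotKerEquivOfSurjective _
      (homologyπ_surjective (P.complex.linearYonedaObj R Y) n)).symm
      ((P.complex.linearYonedaObj R Y).homologyπ n c) = Submodule.Quotient.mk c := by
    rw [LinearEquiv.symm_apply_eq]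
    rfl
  simp only [homologyEquivExt, LinearEquiv.trans_apply]
  rw [this]
  rfl

variable {n} in
lemma homologyEquivExt_naturality {X' : C} {f : X ⟶ X'} {P : ProjectiveResolution X}
    {Q : ProjectiveResolution X'} (φ : Hom P Q f) (x : (Q.complex.linearYonedaObj R Y).homology n) :
    P.homologyEquivExt R Y n (HomologicalComplex.homologyMap (linearYonedaMap R φ.hom Y) n x) =
      (Abelian.Ext.mk₀ f).comp (Q.homologyEquivExt R Y n x) (zero_add n) := by
  obtain ⟨c, rfl⟩ := homologyπ_surjective _ _ x
  have h := ConcreteCategory.congr_hom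
    (HomologicalComplex.homologyπ_naturality (linearYonedaMap R φ.hom Y) n) c
  refine (congrArg _ h).trans ?_
  refine (P.homologyEquivExt_homologyπ n _).trans ?_
  rw [homologyEquivExt_homologyπ, cyclesToExt_apply]
  refine Eq.trans ?_ (mk₀_comp_extMk _ _ rfl (Q.d_comp_cocycle n c) φ).symm
  refine (P.cyclesToExt_apply n _).trans ?_
  congr 1
  exact ConcreteCategory.congr_hom
    (HomologicalComplex.cyclesMap_i (linearYonedaMap R φ.hom Y) n) c

end ProjectiveResolution

variable [HasExt.{v} C] [EnoughProjectives C]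

variable (R X Y) in
/-- The derived functors of `Hom(-, Y)` agree with `Ext` computed in the derived category. -/
noncomputable def extEquivAbelianExt (n : ℕ) :
    ((Ext R C n).obj (op X)).obj Y ≃ₗ[R] Abelian.Ext X Y n :=
  ((projectiveResolution X).isoExt n Y).toLinearEquiv ≪≫ₗ
    (projectiveResolution X).homologyEquivExt R Y n

lemma extEquivAbelianExt_naturality {X' : C} (f : X ⟶ X') (n : ℕ)
    (x : ((Ext R C n).obj (op X')).obj Y) :
    extEquivAbelianExt R X Y n (((Ext R C n).map f.op).app Y x) =
      (Abelian.Ext.mk₀ f).comp (extEquivAbelianExt R X' Y n x) (zero_add n) := by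
  let φ : ProjectiveResolution.Hom (projectiveResolution X) (projectiveResolution X') f :=
    ⟨ProjectiveResolution.lift f _ _,
      (ProjectiveResolution.lift_commutes_zero f _ _).trans
        (congrArg _ (ChainComplex.single₀_map_f_zero f).symm)⟩
  have h : ((projectiveResolution X).isoExt n Y).hom (((Ext R C n).map f.op).app Y x) =
      HomologicalComplex.homologyMap (linearYonedaMap R φ.hom Y) n
        (((projectiveResolution X').isoExt n Y).hom x) :=
    ConcreteCategory.congr_hom (isoExt_hom_naturality f φ n Y) x
  have h' (Z : C) (z : ((Ext R C n).obj (op Z)).obj Y) : extEquivAbelianExt R Z Y n z =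
      (projectiveResolution Z).homologyEquivExt R Y n
        (((projectiveResolution Z).isoExt n Y).hom z) := rfl
  rw [h', h', ← ProjectiveResolution.homologyEquivExt_naturality φ]
  exact congrArg ((projectiveResolution X).homologyEquivExt R Y n) h

end

/-! ### Direct limits of Ext and their long exact sequences -/

section ColimExt

variable {R : Type v} [CommRing R] {C : Type w} [Category.{v} C] [Abelian C] [Linear R C]
  [HasExt.{v} C]

variable (R) in
/-- Precomposition with a morphism, as a linear map on `Ext`. -/
noncomputable def Abelian.Ext.precompLinear {X X' : C} (f : X ⟶ X') (Y : C) (n : ℕ) :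
    Abelian.Ext X' Y n →ₗ[R] Abelian.Ext X Y n where
  toFun x := (Abelian.Ext.mk₀ f).comp x (zero_add n)
  map_add' _ _ := by simp
  map_smul' _ _ := by simp

variable (R) in
/-- Postcomposition with a class, as a linear map on `Ext`. -/
noncomputable def Abelian.Ext.postcompLinear (X : C) {Y Z : C} {a b c : ℕ}
    (β : Abelian.Ext Y Z b) (h : a + b = c) :
    Abelian.Ext X Y a →ₗ[R] Abelian.Ext X Z c where
  toFun x := x.comp β h
  map_add' _ _ := by simp
  map_smul' _ _ := by simp

variable (D : ℕᵒᵖ ⥤ C)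

variable (R) in
/-- The transition maps of the direct system `t ↦ Ext(D t, Y)`. -/
noncomputable abbrev extTransition (Y : C) (n : ℕ) (s t : ℕ) (h : s ≤ t) :
    Abelian.Ext (D.obj (op s)) Y n →ₗ[R] Abelian.Ext (D.obj (op t)) Y n :=
  Abelian.Ext.precompLinear R (D.map (homOfLE h).op) Y n

instance (Y : C) (n : ℕ) : DirectedSystem (fun t => Abelian.Ext (D.obj (op t)) Y n)
    (fun s t h => extTransition R D Y n s t h) where
  map_self i x := by
    simp [extTransition, Abelian.Ext.precompLinear]
  map_map i j k hij hjk x := by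
    have : (homOfLE (hij.trans hjk)).op = (homOfLE hjk).op ≫ (homOfLE hij).op := rfl
    simp [extTransition, Abelian.Ext.precompLinear, this]

variable (R) in
/-- The direct limit of `Ext(D t, Y)`. -/
abbrev ColimExt (n : ℕ) (Y : C) : Type v :=
  Module.DirectLimit (fun t => Abelian.Ext (D.obj (op t)) Y n) (extTransition R D Y n)

namespace ColimExt

variable (R) in
/-- Postcomposition with a class, as a linear map on direct limits of `Ext`. -/
noncomputable def postcomp {Y Z : C} {a b c : ℕ} (β : Abelian.Ext Y Z b) (h : a + b = c) :
    ColimExt R D a Y →ₗ[R] ColimExt R D c Z :=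
  Module.DirectLimit.map (fun t => Abelian.Ext.postcompLinear R (D.obj (op t)) β h) (by
    intro i j hij
    ext x
    exact Abelian.Ext.comp_assoc _ _ _ (zero_add a) h (by simpa using h))

variable (R) in
/-- The structure maps to the direct limit. -/
noncomputable abbrev of (n : ℕ) (Y : C) (t : ℕ) :
    Abelian.Ext (D.obj (op t)) Y n →ₗ[R] ColimExt R D n Y :=
  Module.DirectLimit.of R ℕ (fun t => Abelian.Ext (D.obj (op t)) Y n) (extTransition R D Y n) t

lemma postcomp_of {Y Z : C} {a b c : ℕ} (β : Abelian.Ext Y Z b) (h : a + b = c) (t : ℕ)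
    (x : Abelian.Ext (D.obj (op t)) Y a) :
    postcomp R D β h (of R D a Y t x) = of R D c Z t (x.comp β h) :=
  Module.DirectLimit.map_apply_of _ _ _

lemma of_transition {n : ℕ} {Y : C} {s t : ℕ} (h : s ≤ t) (x : Abelian.Ext (D.obj (op s)) Y n) :
    of R D n Y t ((Abelian.Ext.mk₀ (D.map (homOfLE h).op)).comp x (zero_add n)) =
      of R D n Y s x :=
  Module.DirectLimit.of_f (f := extTransition R D Y n) (hij := h)

lemma exists_of {n : ℕ} {Y : C} (x : ColimExt R D n Y) : ∃ t y, of R D n Y t y = x :=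
  Module.DirectLimit.exists_of x

lemma of_eq_zero {n : ℕ} {Y : C} {t : ℕ} {x : Abelian.Ext (D.obj (op t)) Y n}
    (hx : of R D n Y t x = 0) : ∃ (s : ℕ) (h : t ≤ s),
      (Abelian.Ext.mk₀ (D.map (homOfLE h).op)).comp x (zero_add n) = 0 :=
  Module.DirectLimit.of.zero_exact hx

/-- A class that dies in the limit already dies at a finite stage; `H` gives a preimage at that
stage. -/
lemma postcomp_exact {Y Z W : C} {a b c p q : ℕ} (β : Abelian.Ext Y Z p) (γ : Abelian.Ext Z W q)
    (h : a + p = b) (h' : b + q = c)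
    (H : ∀ (X : C) (x : Abelian.Ext X Z b), x.comp γ h' = 0 → ∃ y, Abelian.Ext.comp y β h = x)
    (x : ColimExt R D b Z) (hx : postcomp R D γ h' x = 0) : ∃ y, postcomp R D β h y = x := by
  obtain ⟨t, x, rfl⟩ := exists_of D x
  rw [postcomp_of] at hx
  obtain ⟨s, hs, hx⟩ := of_eq_zero D hx
  rw [← Abelian.Ext.comp_assoc _ _ _ (zero_add _) h' (by omega)] at hx
  obtain ⟨y, hy⟩ := H _ _ hx
  refine ⟨of R D a Y s y, ?_⟩
  rw [postcomp_of, hy, of_transition]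

/-- The kernel of the outgoing map lies in the image of the incoming one, and the quotient by that
kernel embeds in the target. One statement thus serves all three positions of the long exact
sequence. -/
lemma length_le {Y Z W : C} {a b c p q : ℕ} (β : Abelian.Ext Y Z p) (γ : Abelian.Ext Z W q)
    (h : a + p = b) (h' : b + q = c)
    (H : ∀ (X : C) (x : Abelian.Ext X Z b), x.comp γ h' = 0 → ∃ y, Abelian.Ext.comp y β h = x) :
    Module.length R (ColimExt R D b Z) ≤
      Module.length R (ColimExt R D a Y) + Module.length R (ColimExt R D c W) := by
  let f := postcomp R D β h
  let g := postcomp R D γ h'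
  have hk : LinearMap.ker g ≤ LinearMap.range f := fun x hx => postcomp_exact D β γ h h' H x hx
  rw [Module.length_eq_add_of_exact (LinearMap.ker g).subtype (LinearMap.ker g).mkQ
    (Submodule.subtype_injective _) (Submodule.mkQ_surjective _) (LinearMap.exact_subtype_mkQ _)]
  refine add_le_add ?_ ?_
  · refine (Module.length_le_of_injective (Submodule.inclusion hk)
      (Submodule.inclusion_injective hk)).trans ?_
    exact Module.length_le_of_surjective f.rangeRestrict f.surjective_rangeRestrict
  · refine Module.length_le_of_injective ((LinearMap.ker g).liftQ g le_rfl) ?_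
    rw [← LinearMap.ker_eq_bot]
    exact Submodule.ker_liftQ_eq_bot _ _ _ le_rfl

variable {S : ShortComplex C} (hS : S.ShortExact) (n : ℕ)

include hS

lemma length_X₁_le : Module.length R (ColimExt R D (n + 1) S.X₁) ≤
    Module.length R (ColimExt R D n S.X₃) + Module.length R (ColimExt R D (n + 1) S.X₂) :=
  length_le D hS.extClass (Abelian.Ext.mk₀ S.f) rfl (add_zero _) fun _ x hx =>
    Abelian.Ext.covariant_sequence_exact₁ _ hS x hx rfl

lemma length_X₂_le : Module.length R (ColimExt R D n S.X₂) ≤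
    Module.length R (ColimExt R D n S.X₁) + Module.length R (ColimExt R D n S.X₃) :=
  length_le D (Abelian.Ext.mk₀ S.f) (Abelian.Ext.mk₀ S.g) (add_zero _) (add_zero _) fun _ x hx =>
    Abelian.Ext.covariant_sequence_exact₂ _ hS x hx

lemma length_X₃_le : Module.length R (ColimExt R D n S.X₃) ≤
    Module.length R (ColimExt R D n S.X₂) + Module.length R (ColimExt R D (n + 1) S.X₁) :=
  length_le D (Abelian.Ext.mk₀ S.g) hS.extClass (add_zero _) rfl fun _ x hx =>
    Abelian.Ext.covariant_sequence_exact₃ _ hS x rfl hx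

end ColimExt

end ColimExt

/-! ### Local cohomology as a direct limit of Ext modules -/

section LocalCohomology

open localCohomology

variable {R : Type v} [CommRing R]

/-- The forgetful functor preserves filtered colimits, so elements of the categorical colimit, and
equalities between them, come from finite stages, as in the algebraic direct limit. -/
lemma nonempty_directLimit_equiv_of_isColimit {G : ℕ → Type v} [∀ t, AddCommGroup (G t)]
    [∀ t, Module R (G t)] (T : ∀ s t, s ≤ t → G s →ₗ[R] G t)
    [DirectedSystem G (fun s t h => T s t h)] {F : ℕᵒᵖᵒᵖ ⥤ ModuleCat.{v} R} {c : Cocone F}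
    (hc : IsColimit c) (e : ∀ t, F.obj (op (op t)) ≃ₗ[R] G t)
    (he : ∀ s t (h : s ≤ t) x, e t (F.map (homOfLE h).op.op x) = T s t h (e s x)) :
    Nonempty (Module.DirectLimit G T ≃ₗ[R] c.pt) := by
  let φ : Module.DirectLimit G T →ₗ[R] c.pt := Module.DirectLimit.lift R ℕ G T
    (fun t => (c.ι.app (op (op t))).hom ∘ₗ (e t).symm.toLinearMap) (by
      intro s t h x
      have h1 : (e t).symm (T s t h x) = F.map (homOfLE h).op.op ((e s).symm x) := by
        rw [LinearEquiv.symm_apply_eq, he, LinearEquiv.apply_symm_apply]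
      simp only [LinearMap.comp_apply, LinearEquiv.coe_coe]
      rw [h1]
      exact ConcreteCategory.congr_hom (c.w (homOfLE h).op.op) ((e s).symm x))
  have hφ (t : ℕ) (x : G t) :
      φ (Module.DirectLimit.of R ℕ G T t x) = c.ι.app (op (op t)) ((e t).symm x) :=
    Module.DirectLimit.lift_of _ _ _
  have : PreservesFilteredColimitsOfSize.{0, 0} (forget (ModuleCat.{v} R)) :=
    preservesFilteredColimitsOfSize_shrink.{0, v, 0, v} _
  have : IsFiltered ℕᵒᵖᵒᵖ := IsFiltered.of_equivalence (opOpEquivalence ℕ).symm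
  refine ⟨LinearEquiv.ofBijective φ ⟨?_, ?_⟩⟩
  · rw [injective_iff_map_eq_zero]
    intro x hx
    obtain ⟨t, x, rfl⟩ := Module.DirectLimit.exists_of x
    rw [hφ] at hx
    have h0 : c.ι.app (op (op t)) ((e t).symm x) = c.ι.app (op (op t)) 0 := by
      rw [hx, map_zero]
    obtain ⟨⟨⟨s⟩⟩, f, g, hfg⟩ := (Concrete.isColimit_rep_eq_iff_exists F hc _ _).1 h0
    rw [map_zero] at hfg
    have hts : t ≤ s := leOfHom f.unop.unop
    have hf : f = (homOfLE hts).op.op := rfl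
    have := he t s hts ((e t).symm x)
    rw [← hf, hfg, map_zero, LinearEquiv.apply_symm_apply] at this
    rw [← Module.DirectLimit.of_f (f := T) (hij := hts), ← this, map_zero]
  · intro y
    obtain ⟨⟨⟨t⟩⟩, x, hx⟩ := Concrete.isColimit_exists_rep F hc y
    refine ⟨Module.DirectLimit.of R ℕ G T t (e t x), ?_⟩
    rw [hφ, LinearEquiv.symm_apply_apply]
    exact hx

lemma nonempty_colimExt_equiv_localCohomology (I : Ideal R) (n : ℕ) (M : ModuleCat.{v} R) :
    Nonempty (ColimExt R (ringModIdeals (idealPowersDiagram I)) n M ≃ₗ[R]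
      (localCohomology I n).obj M) := by
  -- Local cohomology is a colimit of functors; evaluation at `M` preserves it.
  let E := (evaluation (ModuleCat.{v} R) (ModuleCat.{v} R)).obj M
  let F : ℕᵒᵖᵒᵖ ⥤ ModuleCat.{v} R := diagram (idealPowersDiagram I) n ⋙ E
  let c : Cocone F := E.mapCocone (colimit.cocone (diagram (idealPowersDiagram I) n))
  have hc : IsColimit c := isColimitOfPreserves E
    (colimit.isColimit (diagram (idealPowersDiagram I) n))
  exact nonempty_directLimit_equiv_of_isColimit (F := F) (c := c)
    (extTransition R (ringModIdeals (idealPowersDiagram I)) M n) hc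
    (fun t => extEquivAbelianExt R ((ringModIdeals (idealPowersDiagram I)).obj (op t)) M n)
    (fun s t h x => extEquivAbelianExt_naturality
      ((ringModIdeals (idealPowersDiagram I)).map (homOfLE h).op) n x)

end LocalCohomology

end CategoryTheory

section

open CategoryTheory localCohomology Opposite

/-! ### Finite length of noetherian modules killed by a power of the maximal ideal -/

section Length

variable {R : Type u} [CommRing R]

/-- Dévissage along `𝔪T ⊆ T`: the quotient is a finite-dimensional vector space over the residue
field, and `𝔪T` is killed by one power less. -/
lemma Module.length_ne_top_of_pow_smul_eq_bot [IsLocalRing R] (k : ℕ) (T : Type u)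
    [AddCommGroup T] [Module R T] [IsNoetherian R T]
    (h : IsLocalRing.maximalIdeal R ^ k • (⊤ : Submodule R T) = ⊥) : Module.length R T ≠ ⊤ := by
  induction k generalizing T with
  | zero =>
    have : Subsingleton T := by
      rw [pow_zero, Ideal.one_eq_top, Submodule.top_smul] at h
      rwa [← Submodule.subsingleton_iff R, ← subsingleton_iff_bot_eq_top, eq_comm]
    rw [Module.length_eq_zero]
    exact ENat.zero_ne_top
  | succ k ih =>
    let U : Submodule R T := IsLocalRing.maximalIdeal R • ⊤
    have h1 : Module.length R U ≠ ⊤ := by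
      refine ih U ?_
      apply Submodule.map_injective_of_injective U.subtype_injective
      rw [Submodule.map_smul'', Submodule.map_top, Submodule.range_subtype, Submodule.map_bot,
        ← h, pow_succ, Submodule.mul_smul]
    have h2 : Module.length R (T ⧸ U) ≠ ⊤ := by
      let : Field (R ⧸ IsLocalRing.maximalIdeal R) := Ideal.Quotient.field _
      have : Module.Finite (R ⧸ IsLocalRing.maximalIdeal R) (T ⧸ U) :=
        Module.Finite.of_restrictScalars_finite R _ _
      rw [Module.length_eq_of_surjective (R := R ⧸ IsLocalRing.maximalIdeal R) (S := R)
        Ideal.Quotient.mk_surjective]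
      exact Module.length_ne_top
    rw [Module.length_eq_add_of_exact U.subtype U.mkQ
      (Submodule.subtype_injective _) (Submodule.mkQ_surjective _) (LinearMap.exact_subtype_mkQ _)]
    exact WithTop.add_ne_top.2 ⟨h1, h2⟩

end Length

lemma shortExact_of_exact {R A B C : Type u} [CommRing R] [AddCommGroup A] [Module R A]
    [AddCommGroup B] [Module R B] [AddCommGroup C] [Module R C] {f : A →ₗ[R] B} {g : B →ₗ[R] C}
    (hf : Function.Injective f) (hg : Function.Surjective g) (h : Function.Exact f g) :
    (ShortComplex.mk (ModuleCat.ofHom f) (ModuleCat.ofHom g)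
      (by ext x; exact h.apply_apply_eq_zero x)).ShortExact :=
  ModuleCat.shortComplex_shortExact _ h hf hg

/-! ### Functoriality and subadditivity of the cohomology lengths -/

section HLength

variable (R : Type u) [CommRing R] [IsLocalRing R]

variable {R} in
/-- The direct limit of `Ext(R/𝔪^t, M)`. -/
abbrev LocalExt (n : ℕ) (M : Type u) [AddCommGroup M] [Module R M] : Type u :=
  ColimExt R (ringModIdeals (idealPowersDiagram (IsLocalRing.maximalIdeal R))) n
    (ModuleCat.of R M)

variable {A B C : Type u} [AddCommGroup A] [Module R A] [AddCommGroup B] [Module R B]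
  [AddCommGroup C] [Module R C]

lemma hLength_eq_length_localExt (n : ℕ) :
    hLength R n A = Module.length R (LocalExt (R := R) n A) :=
  (nonempty_colimExt_equiv_localCohomology _ n _).some.length_eq.symm

lemma hLength_le_of_retract (n : ℕ) (i : A →ₗ[R] B) (p : B →ₗ[R] A) (h : p ∘ₗ i = LinearMap.id) :
    hLength R n A ≤ hLength R n B := by
  let F := localCohomology (IsLocalRing.maximalIdeal R) n
  have hF : F.map (ModuleCat.ofHom i) ≫ F.map (ModuleCat.ofHom p) = 𝟙 _ := by
    rw [← F.map_comp, ← ModuleCat.ofHom_comp, h, ModuleCat.ofHom_id, F.map_id]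
  refine Module.length_le_of_injective (F.map (ModuleCat.ofHom i)).hom ?_
  exact Function.LeftInverse.injective (g := (F.map (ModuleCat.ofHom p)).hom)
    fun x => ConcreteCategory.congr_hom hF x

lemma hLength_congr (n : ℕ) (e : A ≃ₗ[R] B) : hLength R n A = hLength R n B :=
  le_antisymm (hLength_le_of_retract R n e.toLinearMap e.symm.toLinearMap (by ext; simp))
    (hLength_le_of_retract R n e.symm.toLinearMap e.toLinearMap (by ext; simp))

lemma hLength_eq_zero_of_subsingleton [Subsingleton A] (n : ℕ) : hLength R n A = 0 := by
  rw [hLength_eq_length_localExt, Module.length_eq_zero_iff]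
  refine subsingleton_of_forall_eq 0 fun x => ?_
  obtain ⟨t, y, rfl⟩ := ColimExt.exists_of _ x
  have : (𝟙 (ModuleCat.of R A)) = 0 := by ext x; exact Subsingleton.elim _ _
  rw [← y.comp_mk₀_id, this, Abelian.Ext.mk₀_zero, Abelian.Ext.comp_zero, map_zero]

variable {R} {f : A →ₗ[R] B} {g : B →ₗ[R] C} (hf : Function.Injective f)
  (hg : Function.Surjective g) (h : Function.Exact f g)

include hf hg h

lemma hLength_left_le (n : ℕ) :
    hLength R (n + 1) A ≤ hLength R n C + hLength R (n + 1) B := by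
  simp only [hLength_eq_length_localExt]
  exact ColimExt.length_X₁_le _ (shortExact_of_exact hf hg h) n

lemma hLength_middle_le (n : ℕ) : hLength R n B ≤ hLength R n A + hLength R n C := by
  simp only [hLength_eq_length_localExt]
  exact ColimExt.length_X₂_le _ (shortExact_of_exact hf hg h) n

lemma hLength_right_le (n : ℕ) : hLength R n C ≤ hLength R n B + hLength R (n + 1) A := by
  simp only [hLength_eq_length_localExt]
  exact ColimExt.length_X₃_le _ (shortExact_of_exact hf hg h) n

end HLength

/-! ### A uniform exponent for power torsion -/

section Torsion

variable {R : Type u} [CommRing R]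

lemma exists_pow_smul_eq_bot (I : Ideal R) (P : Type u) [AddCommGroup P] [Module R P]
    [Module.Finite R P] (h : ∀ x : P, ∃ t : ℕ, ∀ a ∈ I ^ t, a • x = 0) :
    ∃ k : ℕ, I ^ k • (⊤ : Submodule R P) = ⊥ := by
  choose t ht using h
  obtain ⟨s, hs⟩ := Module.Finite.fg_top (R := R) (M := P)
  refine ⟨s.sup t, ?_⟩
  rw [eq_bot_iff, Submodule.smul_le]
  intro a ha x _
  have hx : x ∈ Submodule.span R (s : Set P) := hs ▸ Submodule.mem_top
  have hle : Submodule.span R (s : Set P) ≤ Submodule.torsionBy R P a := by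
    rw [Submodule.span_le]
    intro y hy
    exact ht y a (Ideal.pow_le_pow_right (Finset.le_sup (Finset.mem_coe.1 hy)) ha)
  exact hle hx

end Torsion

/-! ### Finite length in degree zero -/

section ZerothCohomology

variable (R : Type u) [CommRing R] [IsLocalRing R]

variable {R} in
-- A homomorphism from `R/𝔪^t` is determined by the image of `1`, which is killed by `𝔪^t`. These
-- evaluations are compatible with the transition maps, and injectivity passes to the limit.
lemma exists_injective_localExt_zero (N : Type u) [AddCommGroup N] [Module R N] :
    ∃ f : LocalExt (R := R) 0 N →ₗ[R] N, Function.Injective f ∧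
      ∀ x, ∃ t : ℕ, ∀ a ∈ IsLocalRing.maximalIdeal R ^ t, a • f x = 0 := by
  let I := IsLocalRing.maximalIdeal R
  let D := ringModIdeals (idealPowersDiagram I)
  let q (t : ℕ) (a : R) : D.obj (op t) := Ideal.Quotient.mk (I ^ t) a
  have hq (t : ℕ) (a : R) : a • q t 1 = q t a := congrArg (Ideal.Quotient.mk (I ^ t)) (mul_one a)
  let ev (t : ℕ) : Abelian.Ext (D.obj (op t)) (ModuleCat.of R N) 0 →ₗ[R] N :=
    { toFun := fun x => (Abelian.Ext.addEquiv₀ x).hom (q t 1)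
      map_add' := by intro x y; rw [map_add]; rfl
      map_smul' := by
        intro r x
        have : Abelian.Ext.addEquiv₀ (r • x) = r • Abelian.Ext.addEquiv₀ x := by
          apply Abelian.Ext.addEquiv₀.symm.injective
          simp [Abelian.Ext.mk₀_smul]
        rw [this]
        rfl }
  have hev (t : ℕ) (g : D.obj (op t) ⟶ ModuleCat.of R N) :
      ev t (Abelian.Ext.mk₀ g) = g.hom (q t 1) := by
    change (Abelian.Ext.addEquiv₀ (Abelian.Ext.addEquiv₀.symm g)).hom _ = _
    rw [AddEquiv.apply_symm_apply]
  have hsm (t : ℕ) (g : D.obj (op t) ⟶ ModuleCat.of R N) (a : R) :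
      a • g.hom (q t 1) = g.hom (q t a) := by
    rw [← map_smul, hq]
  let F : LocalExt (R := R) 0 N →ₗ[R] N := Module.DirectLimit.lift R ℕ _ _ ev (by
    intro s t h x
    obtain ⟨g, rfl⟩ := (Abelian.Ext.mk₀_bijective _ _).2 x
    change ev t ((Abelian.Ext.mk₀ _).comp (Abelian.Ext.mk₀ g) (zero_add 0)) =
      ev s (Abelian.Ext.mk₀ g)
    rw [Abelian.Ext.mk₀_comp_mk₀, hev, hev]
    rfl)
  have hF (t : ℕ) (x) : F (ColimExt.of R D 0 _ t x) = ev t x := Module.DirectLimit.lift_of _ _ _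
  refine ⟨F, Module.DirectLimit.lift_injective _ _ fun t => ?_, fun x => ?_⟩
  · rw [injective_iff_map_eq_zero]
    intro x hx
    obtain ⟨g, rfl⟩ := (Abelian.Ext.mk₀_bijective _ _).2 x
    rw [hev] at hx
    have : g = 0 := by
      ext x
      obtain ⟨a, rfl⟩ := Ideal.Quotient.mk_surjective x
      exact (hsm t g a).symm.trans (by rw [hx, smul_zero]; rfl)
    rw [this, Abelian.Ext.mk₀_zero]
  · obtain ⟨t, y, rfl⟩ := ColimExt.exists_of D x
    obtain ⟨g, rfl⟩ := (Abelian.Ext.mk₀_bijective _ _).2 y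
    refine ⟨t, fun a ha => ?_⟩
    have h0 : q t a = 0 := Ideal.Quotient.eq_zero_iff_mem.2 ha
    rw [hF, hev, hsm, h0, map_zero]

lemma hLength_zero_ne_top [IsNoetherianRing R] (N : Type u) [AddCommGroup N] [Module R N]
    [Module.Finite R N] : hLength R 0 N ≠ ⊤ := by
  obtain ⟨f, hf, ht⟩ := exists_injective_localExt_zero (R := R) N
  obtain ⟨k, hk⟩ := exists_pow_smul_eq_bot (IsLocalRing.maximalIdeal R) (LinearMap.range f) (by
    rintro ⟨_, x, rfl⟩
    obtain ⟨t, ht⟩ := ht x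
    exact ⟨t, fun a ha => Subtype.ext (ht a ha)⟩)
  rw [hLength_eq_length_localExt, (LinearEquiv.ofInjective f hf).length_eq]
  exact Module.length_ne_top_of_pow_smul_eq_bot k _ hk

end ZerothCohomology

/-! ### Vanishing of higher cohomology for modules killed by a power of the ideal -/

section Vanishing

variable {R : Type u} [CommRing R]

/-- By naturality of the connecting class, killing a class on the kernels kills its dimension shift
on the quotients. -/
lemma Abelian.Ext.mk₀_comp_extClass_comp_eq_zero {C : Type*} [Category C] [Abelian C] [HasExt.{u} C]
    {S S' : ShortComplex C} (hS : S.ShortExact) (hS' : S'.ShortExact) (φ : S' ⟶ S) {T : C}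
    {j l : ℕ} (hl : 1 + j = l) (e : Abelian.Ext S.X₁ T j)
    (h : (Abelian.Ext.mk₀ φ.τ₁).comp e (zero_add j) = 0) :
    (Abelian.Ext.mk₀ φ.τ₃).comp (hS.extClass.comp e hl) (zero_add l) = 0 := by
  rw [← Abelian.Ext.comp_assoc _ _ _ (zero_add 1) hl (by omega),
    ← ShortComplex.ShortExact.extClass_naturality hS' hS φ,
    Abelian.Ext.comp_assoc _ _ _ (add_zero 1) (zero_add j) (by omega), h, Abelian.Ext.comp_zero]

/-- Dimension shifting along a free cover `F → X` with kernel `K` moves the class to `K` in one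
degree lower. By Artin–Rees, the part of `K` inside a high `I^m F` lies in `I^s K`, where the
induction hypothesis applies. In degree 0, a homomorphism maps `I^k X` into `I^k T = 0`. -/
lemma exists_pow_smul_restrict_eq_zero [IsNoetherianRing R] (I : Ideal R) (T : ModuleCat.{u} R)
    {k : ℕ} (hT : I ^ k • (⊤ : Submodule R T) = ⊥) (j : ℕ) (X : Type u) [AddCommGroup X]
    [Module R X] [Module.Finite R X] (e : Abelian.Ext (ModuleCat.of R X) T j) :
    ∃ s : ℕ, (Abelian.Ext.mk₀ (ModuleCat.ofHom (I ^ s • (⊤ : Submodule R X)).subtype)).comp e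
      (zero_add j) = 0 := by
  induction j generalizing X with
  | zero =>
    refine ⟨k, ?_⟩
    obtain ⟨g, rfl⟩ := Abelian.Ext.addEquiv₀.symm.surjective e
    change (Abelian.Ext.mk₀ _).comp (Abelian.Ext.mk₀ g) _ = 0
    rw [Abelian.Ext.mk₀_comp_mk₀, Abelian.Ext.mk₀_eq_zero_iff]
    ext ⟨x, hx⟩
    have h1 : Submodule.map g.hom (I ^ k • (⊤ : Submodule R X)) ≤ ⊥ := by
      rw [Submodule.map_smul'', ← hT]
      exact Submodule.smul_mono le_rfl le_top
    exact h1 (Submodule.mem_map_of_mem hx)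
  | succ j ih =>
    obtain ⟨n, π, hπ⟩ := Module.Finite.exists_fin' R X
    have hS := shortExact_of_exact (LinearMap.ker π).subtype_injective hπ
      (LinearMap.exact_subtype_ker_map π)
    obtain ⟨e, rfl⟩ := Abelian.Ext.contravariant_sequence_exact₃ hS T e
      (Abelian.Ext.eq_zero_of_projective _) (add_comm 1 j)
    obtain ⟨s, hs⟩ := ih (LinearMap.ker π) e
    -- `k₀` is the Artin–Rees constant, so the exponent `k₀ + s` forces the new kernel into `I^s •
    -- ker π`.
    obtain ⟨k₀, hk₀⟩ := Ideal.exists_pow_inf_eq_pow_smul I (LinearMap.ker π)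
    let F' : Submodule R (Fin n → R) := I ^ (k₀ + s) • ⊤
    let X' : Submodule R X := I ^ (k₀ + s) • ⊤
    have hmap : F'.map π = X' := by
      rw [Submodule.map_smul'', Submodule.map_top, LinearMap.range_eq_top.2 hπ]
    let π' : F' →ₗ[R] X' := π.restrict fun x hx => hmap ▸ Submodule.mem_map_of_mem hx
    have hπ' : Function.Surjective π' := by
      rintro ⟨x, hx⟩
      rw [← hmap] at hx
      obtain ⟨y, hy, rfl⟩ := hx
      exact ⟨⟨y, hy⟩, rfl⟩
    have hS' := shortExact_of_exact (A := LinearMap.ker π') (B := F') (C := X')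
      (f := (LinearMap.ker π').subtype) (g := π')
      (LinearMap.ker π').subtype_injective hπ' (LinearMap.exact_subtype_ker_map π')
    have hK (x : LinearMap.ker π') : (x : F').1 ∈ I ^ s • LinearMap.ker π := by
      have h1 : (x : F').1 ∈ I ^ (k₀ + s) • (⊤ : Submodule R (Fin n → R)) ⊓ LinearMap.ker π :=
        ⟨(x : F').2, congrArg Subtype.val x.2⟩
      rw [hk₀ _ (Nat.le_add_right _ _), Nat.add_sub_cancel_left] at h1
      exact Submodule.smul_mono le_rfl inf_le_right h1
    have hK' (x : LinearMap.ker π') : (⟨(x : F').1, congrArg Subtype.val x.2⟩ : LinearMap.ker π) ∈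
        I ^ s • (⊤ : Submodule R (LinearMap.ker π)) := by
      have h1 : Submodule.map (LinearMap.ker π).subtype (I ^ s • ⊤) = I ^ s • LinearMap.ker π := by
        rw [Submodule.map_smul'', Submodule.map_top, Submodule.range_subtype]
      have h2 := hK x
      rw [← h1] at h2
      obtain ⟨y, hy, hyx⟩ := h2
      exact (Subtype.ext hyx : y = ⟨(x : F').1, congrArg Subtype.val x.2⟩) ▸ hy
    let τ : LinearMap.ker π' →ₗ[R] (I ^ s • ⊤ : Submodule R (LinearMap.ker π)) :=
      { toFun := fun x => ⟨⟨(x : F').1, congrArg Subtype.val x.2⟩, hK' x⟩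
        map_add' := fun _ _ => rfl
        map_smul' := fun _ _ => rfl }
    let τ₁ : ModuleCat.of R (LinearMap.ker π') ⟶ ModuleCat.of R (LinearMap.ker π) :=
      ModuleCat.ofHom τ ≫ ModuleCat.ofHom (X := ↥(I ^ s • ⊤ : Submodule R (LinearMap.ker π)))
        (Y := ↥(LinearMap.ker π)) (Submodule.subtype _)
    refine ⟨k₀ + s, Abelian.Ext.mk₀_comp_extClass_comp_eq_zero hS hS'
      { τ₁ := τ₁
        τ₂ := ModuleCat.ofHom F'.subtype
        τ₃ := ModuleCat.ofHom X'.subtype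
        comm₁₂ := rfl
        comm₂₃ := rfl } _ e ?_⟩
    change (Abelian.Ext.mk₀ (_ ≫ _)).comp e (zero_add j) = 0
    rw [← Abelian.Ext.mk₀_comp_mk₀_assoc, hs, Abelian.Ext.comp_zero]

/-- A class on `R/I^t` in positive degree is the shift of a class on `I^t`. Since `I^(t+s) = I^s
I^t`, the latter dies on `I^(t+s)` for some `s`, and hence the former dies on `R/I^(t+s)`. -/
lemma subsingleton_colimExt_succ_of_pow_smul_eq_bot [IsNoetherianRing R] (I : Ideal R)
    (T : ModuleCat.{u} R) {k : ℕ} (hT : I ^ k • (⊤ : Submodule R T) = ⊥) (j : ℕ) :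
    Subsingleton (ColimExt R (ringModIdeals (idealPowersDiagram I)) (j + 1) T) := by
  let D := ringModIdeals (idealPowersDiagram I)
  refine subsingleton_of_forall_eq 0 fun x => ?_
  obtain ⟨t, e, rfl⟩ := ColimExt.exists_of D x
  have hS (t : ℕ) := shortExact_of_exact (A := ↥(I ^ t)) (B := R) (C := R ⧸ I ^ t)
    (f := (I ^ t).subtype) (g := (I ^ t).mkQ) (I ^ t).subtype_injective
    (Submodule.mkQ_surjective _) (LinearMap.exact_subtype_mkQ _)
  have : Projective (ModuleCat.of R R) :=
    ModuleCat.projective_of_free (Module.Basis.singleton Unit R)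
  obtain ⟨e, rfl⟩ := Abelian.Ext.contravariant_sequence_exact₃ (hS t) T e
    (Abelian.Ext.eq_zero_of_projective _) (add_comm 1 j)
  obtain ⟨s, hs⟩ := exists_pow_smul_restrict_eq_zero I T hT j (↥(I ^ t)) e
  have hle : t ≤ t + s := Nat.le_add_right t s
  have hmem (x : ↥(I ^ (t + s))) : (⟨x.1, Ideal.pow_le_pow_right hle x.2⟩ : ↥(I ^ t)) ∈
      I ^ s • (⊤ : Submodule R ↥(I ^ t)) := by
    have h1 : Submodule.map (I ^ t).subtype (I ^ s • ⊤) = I ^ s • I ^ t := by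
      rw [Submodule.map_smul'', Submodule.map_top, Submodule.range_subtype]
    have h2 : x.1 ∈ I ^ s • I ^ t := by
      rw [smul_eq_mul, ← pow_add, add_comm]
      exact x.2
    rw [← h1] at h2
    obtain ⟨y, hy, hyx⟩ := h2
    exact (Subtype.ext hyx : y = ⟨x.1, Ideal.pow_le_pow_right hle x.2⟩) ▸ hy
  let τ : ↥(I ^ (t + s)) →ₗ[R] (I ^ s • ⊤ : Submodule R ↥(I ^ t)) :=
    { toFun := fun x => ⟨⟨x.1, Ideal.pow_le_pow_right hle x.2⟩, hmem x⟩
      map_add' := fun _ _ => rfl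
      map_smul' := fun _ _ => rfl }
  refine (ColimExt.of_transition D hle _).symm.trans ?_
  let τ₁ : ModuleCat.of R ↥(I ^ (t + s)) ⟶ ModuleCat.of R ↥(I ^ t) :=
    ModuleCat.ofHom τ ≫ ModuleCat.ofHom (I ^ s • ⊤ : Submodule R ↥(I ^ t)).subtype
  refine (congrArg _ (Abelian.Ext.mk₀_comp_extClass_comp_eq_zero (hS t) (hS (t + s))
    { τ₁ := τ₁
      τ₂ := 𝟙 _
      τ₃ := D.map (homOfLE hle).op
      comm₁₂ := rfl
      comm₂₃ := rfl } _ e ?_)).trans (map_zero _)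
  change (Abelian.Ext.mk₀ (_ ≫ _)).comp e (zero_add j) = 0
  rw [← Abelian.Ext.mk₀_comp_mk₀_assoc, hs, Abelian.Ext.comp_zero]

lemma hLength_succ_eq_zero_of_pow_smul_eq_bot [IsLocalRing R] [IsNoetherianRing R] (T : Type u)
    [AddCommGroup T] [Module R T] {k : ℕ}
    (hT : IsLocalRing.maximalIdeal R ^ k • (⊤ : Submodule R T) = ⊥) (j : ℕ) :
    hLength R (j + 1) T = 0 := by
  rw [hLength_eq_length_localExt, Module.length_eq_zero_iff]
  exact subsingleton_colimExt_succ_of_pow_smul_eq_bot _ (ModuleCat.of R T) hT j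

end Vanishing

/-! ### Vanishing of cohomology below the depth -/

section RegularSequence

variable {R : Type u} [CommRing R]

/-- The class comes from some stage `R/I^t`, on which `r^t` is already zero. -/
lemma exists_pow_smul_eq_zero_colimExt {I : Ideal R} {r : R} (hr : r ∈ I) {n : ℕ}
    {M : ModuleCat.{u} R} (x : ColimExt R (ringModIdeals (idealPowersDiagram I)) n M) :
    ∃ t : ℕ, r ^ t • x = 0 := by
  obtain ⟨t, y, rfl⟩ := ColimExt.exists_of _ x
  refine ⟨t, ?_⟩
  have h : r ^ t • 𝟙 ((ringModIdeals (idealPowersDiagram I)).obj (op t)) = 0 := by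
    ext x
    obtain ⟨a, rfl⟩ := Ideal.Quotient.mk_surjective x
    exact Ideal.Quotient.eq_zero_iff_mem.2 (Ideal.mul_mem_right a _ (Ideal.pow_mem_pow hr t))
  rw [← map_smul, ← y.mk₀_id_comp, ← Abelian.Ext.smul_comp, ← Abelian.Ext.mk₀_smul, h,
    Abelian.Ext.mk₀_zero, Abelian.Ext.zero_comp, map_zero]

open scoped Pointwise in
-- The first element `r` acts injectively on `H^n(M)`, because `H^(n-1)(M/rM)` vanishes by induction
-- (for `n = 0` because `Hom` is left exact). Every class is also killed by a power of `r`, so every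
-- class is zero.
lemma subsingleton_colimExt_of_isWeaklyRegular {I : Ideal R} (rs : List R) (hrs : ∀ r ∈ rs, r ∈ I)
    (M : Type u) [AddCommGroup M] [Module R M] (h : RingTheory.Sequence.IsWeaklyRegular M rs)
    (n : ℕ) (hn : n < rs.length) :
    Subsingleton (ColimExt R (ringModIdeals (idealPowersDiagram I)) n (ModuleCat.of R M)) := by
  induction rs generalizing M n with
  | nil => simp at hn
  | cons r rs ih =>
    let D := ringModIdeals (idealPowersDiagram I)
    rw [RingTheory.Sequence.isWeaklyRegular_cons_iff] at h
    have hS := shortExact_of_exact (f := LinearMap.lsmul R M r)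
      (g := (r • (⊤ : Submodule R M)).mkQ) h.1 (Submodule.mkQ_surjective _)
      (LinearMap.exact_lsmul_mkQ_smul_top M r)
    have hreg (x : ColimExt R D n (ModuleCat.of R M)) (hx : r • x = 0) : x = 0 := by
      obtain ⟨t, x, rfl⟩ := ColimExt.exists_of D x
      rw [← map_smul] at hx
      obtain ⟨s, hs, hx⟩ := ColimExt.of_eq_zero D hx
      rw [← ColimExt.of_transition D hs]
      rw [Abelian.Ext.comp_smul, Abelian.Ext.smul_eq_comp_mk₀] at hx
      have hr : r • 𝟙 (ModuleCat.of R M) = ModuleCat.ofHom (LinearMap.lsmul R M r) := rfl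
      rw [hr] at hx
      cases n with
      | zero =>
        have : Mono (ModuleCat.ofHom (LinearMap.lsmul R M r)) := hS.mono_f
        have h0 := Abelian.Ext.postcomp_mk₀_injective_of_mono (D.obj (op s))
          (ModuleCat.ofHom (LinearMap.lsmul R M r)) (hx.trans (map_zero _).symm)
        rw [h0, map_zero]
      | succ n =>
        obtain ⟨y, hy⟩ := Abelian.Ext.covariant_sequence_exact₁ _ hS _ hx rfl
        have := ih (fun r' h' => hrs r' (List.mem_cons_of_mem _ h')) _ h.2 n
          (by simpa using hn)
        rw [← hy, ← ColimExt.postcomp_of,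
          Subsingleton.elim (ColimExt.of R D n (ModuleCat.of R (QuotSMulTop r M)) s y) 0, map_zero]
    refine subsingleton_of_forall_eq 0 fun x => ?_
    obtain ⟨t, ht⟩ := exists_pow_smul_eq_zero_colimExt (hrs r List.mem_cons_self) x
    induction t with
    | zero => simpa using ht
    | succ t iht =>
      refine iht (hreg _ ?_)
      rwa [smul_smul, ← pow_succ']

lemma hLength_eq_zero_of_lt_localDepth [IsLocalRing R] {n : ℕ} (hn : (n : ℕ∞) < localDepth R) :
    hLength R n R = 0 := by
  simp only [localDepth, lt_iSup_iff] at hn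
  obtain ⟨rs, ⟨hreg, hmem⟩, hlt⟩ := hn
  rw [hLength_eq_length_localExt, Module.length_eq_zero_iff]
  exact subsingleton_colimExt_of_isWeaklyRegular rs hmem R hreg.toIsWeaklyRegular n
    (by exact_mod_cast hlt)

end RegularSequence

end

/-! ### Local freeness as factorization through free modules -/

section AwayFrom

variable {R : Type u} [CommRing R]

/-- Some power of `f`, as an endomorphism of `N`, factors through a free module of finite rank. -/
def PowFactorsThroughFree (f : R) (N : Type u) [AddCommGroup N] [Module R N] : Prop :=
  ∃ (c n : ℕ) (s : N →ₗ[R] (Fin n → R)) (π : (Fin n → R) →ₗ[R] N), ∀ x, π (s x) = f ^ c • x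

/-- The localized surjection splits, and finite presentation allows clearing denominators: `u` turns
the section into a map over `R`, and `v` turns the identity it satisfies after localization into one
over `R`. -/
lemma exists_section_smul_of_free_localizedModule [IsNoetherianRing R] {N : Type u}
    [AddCommGroup N] [Module R N] [Module.Finite R N] {n : ℕ} {π : (Fin n → R) →ₗ[R] N}
    (hπ : Function.Surjective π) (S : Submonoid R)
    [Module.Free (Localization S) (LocalizedModule S N)] :
    ∃ (a : S) (s : N →ₗ[R] (Fin n → R)), ∀ x, π (s x) = (a : R) • x := by
  obtain ⟨σ, hσ⟩ := Module.projective_lifting_property (LocalizedModule.map S π) LinearMap.id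
    (LocalizedModule.map_surjective S π hπ)
  have : Module.FinitePresentation R N := Module.finitePresentation_of_finite R N
  obtain ⟨h, u, hu⟩ := Module.FinitePresentation.exists_lift_of_isLocalizedModule S
    (LocalizedModule.mkLinearMap S (Fin n → R))
    ((σ.restrictScalars R) ∘ₗ LocalizedModule.mkLinearMap S N)
  have h1 : (LocalizedModule.mkLinearMap S N).comp (π ∘ₗ h) =
      (LocalizedModule.mkLinearMap S N).comp ((u : R) • LinearMap.id) := by
    ext x
    have h2 := congrArg (LocalizedModule.map S π) (LinearMap.congr_fun hu x)
    have h3 := LinearMap.congr_fun hσ (LocalizedModule.mkLinearMap S N x)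
    have h4 : LocalizedModule.map S π ((LocalizedModule.mkLinearMap S (Fin n → R)) (h x)) =
        LocalizedModule.mkLinearMap S N (π (h x)) := by
      simp [LocalizedModule.map_mk]
    refine h4.symm.trans (h2.trans ?_)
    change LocalizedModule.map S π ((u : R) • σ (LocalizedModule.mkLinearMap S N x)) =
      LocalizedModule.mkLinearMap S N ((u : R) • x)
    rw [LinearMap.map_smul_of_tower, map_smul]
    exact congrArg _ h3
  obtain ⟨v, hv⟩ := Module.Finite.exists_smul_of_comp_eq_of_isLocalizedModule S
    (LocalizedModule.mkLinearMap S N) _ _ h1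
  refine ⟨v * u, (v : R) • h, fun x => ?_⟩
  have := LinearMap.congr_fun hv x
  rw [LinearMap.smul_apply, map_smul]
  refine this.trans ?_
  exact smul_smul _ _ _

lemma powFactorsThroughFree_of_isLocallyFree [IsLocalRing R] [IsNoetherianRing R] {N : Type u}
    [AddCommGroup N] [Module R N] [Module.Finite R N]
    (hN : IsLocallyFreeOfConstantRankOnPunctured R N) {f : R}
    (hf : f ∈ IsLocalRing.maximalIdeal R) : PowFactorsThroughFree f N := by
  obtain ⟨r, hr⟩ := hN
  obtain ⟨n, π, hπ⟩ := Module.Finite.exists_fin' R N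
  -- The scalars whose multiplication on `N` factors through `π` form an ideal. No prime other than
  -- `𝔪` contains it, so `f ∈ 𝔪` lies in its radical.
  let J : Ideal R :=
    { carrier := {a | ∃ s : N →ₗ[R] (Fin n → R), ∀ x, π (s x) = a • x}
      zero_mem' := ⟨0, fun x => by simp⟩
      add_mem' := by
        rintro a b ⟨s, hs⟩ ⟨t, ht⟩
        exact ⟨s + t, fun x => by simp [hs, ht, add_smul]⟩
      smul_mem' := by
        rintro a b ⟨s, hs⟩
        exact ⟨a • s, fun x => by simp [hs, mul_smul]⟩ }
  have hJ : f ∈ J.radical := by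
    rw [Ideal.radical_eq_sInf, Submodule.mem_sInf]
    intro (P : Ideal R) ⟨hJP, (hP : P.IsPrime)⟩
    by_contra hfP
    have hPm : P ≠ IsLocalRing.maximalIdeal R := fun h => hfP (h ▸ hf)
    have := (hr ⟨P, hP⟩ hPm).1
    obtain ⟨a, s, hs⟩ := exists_section_smul_of_free_localizedModule hπ P.primeCompl
    exact a.2 (hJP ⟨s, hs⟩)
  obtain ⟨c, s, hs⟩ := hJ
  exact ⟨c, n, s, π, hs⟩

lemma exists_pow_smul_eq_bot_of_span [IsNoetherianRing R] {S : Set R} {I : Ideal R}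
    (hS : Ideal.span S = I) (P : Type u) [AddCommGroup P] [Module R P]
    (h : ∀ f ∈ S, ∃ c : ℕ, ∀ x : P, f ^ c • x = 0) :
    ∃ k : ℕ, I ^ k • (⊤ : Submodule R P) = ⊥ := by
  have hle : I ≤ (Module.annihilator R P).radical := by
    rw [← hS, Ideal.span_le]
    intro f hf
    obtain ⟨c, hc⟩ := h f hf
    exact ⟨c, Module.mem_annihilator.2 hc⟩
  obtain ⟨k, hk⟩ := Ideal.exists_pow_le_of_le_radical_of_fg hle (IsNoetherian.noetherian I)
  refine ⟨k, ?_⟩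
  rw [eq_bot_iff, Submodule.smul_le]
  exact fun a ha x _ => Module.mem_annihilator.1 (hk ha) x

end AwayFrom

/-! ### Finiteness below the depth and the one-step tensor inequality -/

section Free

variable {R : Type u} [CommRing R] [IsLocalRing R]

lemma hLength_pi_le (n b : ℕ) (N : Type u) [AddCommGroup N] [Module R N] :
    hLength R n (Fin b → N) ≤ b * hLength R n N := by
  induction b with
  | zero => rw [hLength_eq_zero_of_subsingleton]; exact zero_le
  | succ b ih =>
    have h := hLength_middle_le (f := LinearMap.single R (fun _ : Fin (b + 1) => N) 0)
      (g := LinearMap.funLeft R N Fin.succ) (by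
        rw [LinearMap.coe_single]
        exact Pi.single_injective 0)
      (LinearMap.funLeft_surjective_of_injective _ _ _ (Fin.succ_injective b)) (by
        intro x
        constructor
        · intro hx
          refine ⟨x 0, funext fun i => ?_⟩
          refine Fin.cases ?_ (fun i => ?_) i
          · simp
          · simpa using (congr_fun hx i).symm
        · rintro ⟨y, rfl⟩
          ext i
          simp [LinearMap.funLeft_apply]) n
    refine h.trans ?_
    rw [Nat.cast_succ, add_mul, one_mul, add_comm]
    gcongr

lemma hLength_free_eq_zero {n : ℕ} (h : hLength R n R = 0) (F : Type u) [AddCommGroup F]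
    [Module R F] [Module.Finite R F] [Module.Free R F] : hLength R n F = 0 := by
  rw [hLength_congr R n (Module.finBasis R F).equivFun]
  simpa [h] using hLength_pi_le (R := R) n (Module.finrank R F) R

variable [IsNoetherianRing R]

/-- The kernel has no cohomology in positive degrees, so dividing it out changes nothing there. -/
lemma hLength_succ_range_eq {A B : Type u} [AddCommGroup A] [Module R A] [AddCommGroup B]
    [Module R B] (t : A →ₗ[R] B) {k : ℕ}
    (hk : IsLocalRing.maximalIdeal R ^ k • (⊤ : Submodule R (LinearMap.ker t)) = ⊥) (n : ℕ) :
    hLength R (n + 1) (LinearMap.range t) = hLength R (n + 1) A := by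
  have ht : Function.Exact (LinearMap.ker t).subtype t.rangeRestrict := by
    have := LinearMap.exact_subtype_ker_map t.rangeRestrict
    rwa [LinearMap.ker_rangeRestrict] at this
  apply le_antisymm
  · have := hLength_right_le (R := R) (LinearMap.ker t).subtype_injective
      t.surjective_rangeRestrict ht (n + 1)
    rwa [hLength_succ_eq_zero_of_pow_smul_eq_bot _ hk, add_zero] at this
  · have := hLength_middle_le (R := R) (LinearMap.ker t).subtype_injective
      t.surjective_rangeRestrict ht (n + 1)
    rwa [hLength_succ_eq_zero_of_pow_smul_eq_bot _ hk, zero_add] at this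

/-- The factorizations for all `f ∈ S` combine into `t : N → F` with `F` free and kernel killed by a
power of `𝔪`. As `H^(n+1)(F) = 0`, the problem passes to the cokernel of `t` in degree `n`. Unlike
being free of constant rank, the factorization property is visibly inherited by this cokernel. -/
lemma hLength_ne_top_of_lt_localDepth {S : Finset R}
    (hS : Ideal.span (S : Set R) = IsLocalRing.maximalIdeal R) (n : ℕ)
    (hn : (n : ℕ∞) < localDepth R) (N : Type u) [AddCommGroup N] [Module R N] [Module.Finite R N]
    (hN : ∀ f ∈ S, PowFactorsThroughFree f N) : hLength R n N ≠ ⊤ := by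
  induction n generalizing N with
  | zero => exact hLength_zero_ne_top R N
  | succ n ih =>
    have hn' : (n : ℕ∞) < localDepth R :=
      lt_of_le_of_lt (by exact_mod_cast Nat.le_succ n) hn
    choose c b s π hsπ using fun f : S => hN f f.2
    let F := (f : S) → Fin (b f) → R
    let t : N →ₗ[R] F := LinearMap.pi s
    let ρ (f : S) : F →ₗ[R] N := π f ∘ₗ LinearMap.proj f
    have hρ (f : S) (x : N) : ρ f (t x) = (f : R) ^ c f • x := hsπ f x
    obtain ⟨k, hk⟩ := exists_pow_smul_eq_bot_of_span hS (LinearMap.ker t) (fun f hf =>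
      ⟨c ⟨f, hf⟩, fun x => Subtype.ext (by
        have := hρ ⟨f, hf⟩ x
        rw [x.2, map_zero] at this
        exact this.symm)⟩)
    have h1 := hLength_succ_range_eq t hk n
    have h2 := hLength_left_le (R := R) (LinearMap.range t).subtype_injective
      (Submodule.mkQ_surjective _) (LinearMap.exact_subtype_mkQ _) n
    rw [hLength_free_eq_zero (hLength_eq_zero_of_lt_localDepth hn) F, add_zero] at h2
    have h3 : hLength R n (F ⧸ LinearMap.range t) ≠ ⊤ := by
      refine ih hn' _ fun f hf => ?_
      let e := (Module.finBasis R F).equivFun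
      -- `f^c - tρ` vanishes on the range of `t` because `ρt = f^c`, and modulo that range it is
      -- `f^c`. So `f^c` on the cokernel factors through `F`.
      let σ : (F ⧸ LinearMap.range t) →ₗ[R] F := (LinearMap.range t).liftQ
        (f ^ c ⟨f, hf⟩ • LinearMap.id - t ∘ₗ ρ ⟨f, hf⟩) (by
          rintro _ ⟨x, rfl⟩
          simp [hρ])
      refine ⟨c ⟨f, hf⟩, _, e.toLinearMap ∘ₗ σ, (LinearMap.range t).mkQ ∘ₗ e.symm.toLinearMap, ?_⟩
      intro y
      obtain ⟨y, rfl⟩ := Submodule.mkQ_surjective _ y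
      simp [σ]
    exact ne_top_of_le_ne_top h3 (h1.symm.le.trans h2)

/-- The kernel of `K ⊗ N → R^b ⊗ N` is killed by a power of `𝔪`, so the image has the same
positive-degree cohomology as `K ⊗ N`. The sequence from this image to `R^b ⊗ N ≅ N^b` to `M ⊗ N`
then gives the bound. -/
lemma hLength_tensor_le {S : Finset R}
    (hS : Ideal.span (S : Set R) = IsLocalRing.maximalIdeal R)
    {N : Type u} [AddCommGroup N] [Module R N] [Module.Finite R N]
    (hN : ∀ f ∈ S, PowFactorsThroughFree f N) {K M : Type u} [AddCommGroup K] [Module R K]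
    [AddCommGroup M] [Module R M] {b : ℕ} {i : K →ₗ[R] (Fin b → R)} {g : (Fin b → R) →ₗ[R] M}
    (hi : Function.Injective i) (hg : Function.Surjective g) (h : Function.Exact i g) (n : ℕ) :
    hLength R n (M ⊗[R] N) ≤ b * hLength R n N + hLength R (n + 1) (K ⊗[R] N) := by
  let t := i.rTensor N
  obtain ⟨k, hk⟩ := exists_pow_smul_eq_bot_of_span hS (LinearMap.ker t) (fun f hf => by
    obtain ⟨c, b', s, π, hsπ⟩ := hN f hf
    refine ⟨c, fun x => Subtype.ext ?_⟩
    -- Tensoring with the free module keeps `i` injective, and the image of this element under it is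
    -- the image of `t x = 0`. Applying `π` afterwards gives `f^c x = 0`.
    have h0 : s.lTensor K x.1 = 0 := by
      apply Module.Flat.rTensor_preserves_injective_linearMap (M := Fin b' → R) i hi
      have : i.rTensor (Fin b' → R) (s.lTensor K x.1) = s.lTensor (Fin b → R) (t x.1) := by
        rw [← LinearMap.comp_apply, ← LinearMap.comp_apply, LinearMap.rTensor_comp_lTensor,
          LinearMap.lTensor_comp_rTensor]
      rw [this, x.2, map_zero, map_zero]
    have h1 : π.lTensor K (s.lTensor K x.1) = f ^ c • x.1 := by
      rw [← LinearMap.comp_apply, ← LinearMap.lTensor_comp]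
      have : π ∘ₗ s = f ^ c • LinearMap.id := LinearMap.ext hsπ
      rw [this, LinearMap.lTensor_smul, LinearMap.lTensor_id]
      rfl
    rw [h0, map_zero] at h1
    exact h1.symm)
  have h1 : hLength R (n + 1) (LinearMap.range t) = hLength R (n + 1) (K ⊗[R] N) :=
    hLength_succ_range_eq t hk n
  have ht : Function.Exact (LinearMap.range t).subtype (g.rTensor N) := by
    rw [LinearMap.exact_iff, Submodule.range_subtype]
    exact LinearMap.exact_iff.1 (rTensor_exact N h hg)
  have h2 := hLength_right_le (A := LinearMap.range t) (B := (Fin b → R) ⊗[R] N) (C := M ⊗[R] N)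
    (LinearMap.range t).subtype_injective (LinearMap.rTensor_surjective N hg) ht n
  refine h2.trans (add_le_add ?_ h1.le)
  rw [hLength_congr R n ((TensorProduct.comm R (Fin b → R) N).trans
    (TensorProduct.piScalarRight R R N (Fin b)))]
  exact hLength_pi_le n b N

end Free

/-! ### Iteration along the minimal free resolution -/

section Resolution

variable {R : Type u} [CommRing R] [IsLocalRing R] {M N : Type u} [AddCommGroup M] [Module R M]
  [AddCommGroup N] [Module R N]

lemma hLength_tensor_le_of_projective [Module.Projective R M] {b : ℕ} {g : (Fin b → R) →ₗ[R] M}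
    (hg : Function.Surjective g) (n : ℕ) : hLength R n (M ⊗[R] N) ≤ b * hLength R n N := by
  obtain ⟨s, hs⟩ := Module.projective_lifting_property g LinearMap.id hg
  refine (hLength_le_of_retract R n (s.rTensor N) (g.rTensor N) ?_).trans ?_
  · rw [← LinearMap.rTensor_comp, hs, LinearMap.rTensor_id]
  · rw [hLength_congr R n ((TensorProduct.comm R (Fin b → R) N).trans
      (TensorProduct.piScalarRight R R N (Fin b)))]
    exact hLength_pi_le n b N

namespace MinimalFreeResolution

variable (X : MinimalFreeResolution R M)

lemma exact_subtype_rangeRestrict (i : ℕ) :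
    Function.Exact (LinearMap.range (X.d (i + 1))).subtype (X.d i).rangeRestrict := by
  rw [LinearMap.exact_iff, Submodule.range_subtype, LinearMap.ker_rangeRestrict]
  exact LinearMap.exact_iff.1 (X.exact_succ i)

lemma exact_subtype_aug : Function.Exact (LinearMap.range (X.d 0)).subtype X.aug := by
  rw [LinearMap.exact_iff, Submodule.range_subtype]
  exact LinearMap.exact_iff.1 X.exact_zero

/-- The range of `d q` is the syzygy of index `q + 1`, and each passage to a syzygy lowers the bound
by one. For `n = 0` the conclusion is projectivity. -/
lemma hasProjectiveDimensionLT_range (q n : ℕ)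
    [h : CategoryTheory.HasProjectiveDimensionLT (ModuleCat.of R M) (q + n + 2)] :
    CategoryTheory.HasProjectiveDimensionLT
      (ModuleCat.of R (LinearMap.range (X.d q))) (n + 1) := by
  have hproj (i : ℕ) : CategoryTheory.Projective (ModuleCat.of R (Fin (X.rank i) → R)) :=
    (IsProjective.iff_projective _).1 inferInstance
  induction q generalizing n with
  | zero =>
    rw [zero_add] at h
    exact ((shortExact_of_exact (LinearMap.range (X.d 0)).subtype_injective X.aug_surjective
      X.exact_subtype_aug).hasProjectiveDimensionLT_X₃_iff n (hproj 0)).1 h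
  | succ q ih =>
    have : CategoryTheory.HasProjectiveDimensionLT (ModuleCat.of R M) (q + (n + 1) + 2) := by
      convert h using 1
      ring
    exact ((shortExact_of_exact (LinearMap.range (X.d (q + 1))).subtype_injective
      (X.d q).surjective_rangeRestrict
      (X.exact_subtype_rangeRestrict q)).hasProjectiveDimensionLT_X₃_iff n (hproj (q + 1))).1
      (ih (n + 1))

variable [IsNoetherianRing R] [Module.Finite R N]

lemma hLength_tensor_le_sum_add {S : Finset R}
    (hS : Ideal.span (S : Set R) = IsLocalRing.maximalIdeal R)
    (hN : ∀ f ∈ S, PowFactorsThroughFree f N) (q : ℕ) :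
    hLength R 0 (M ⊗[R] N) ≤ ∑ i ∈ Finset.range (q + 1), (X.rank i : ℕ∞) * hLength R i N +
      hLength R (q + 1) (LinearMap.range (X.d q) ⊗[R] N) := by
  induction q with
  | zero =>
    refine le_of_le_of_eq ?_ (congrArg (· + _) (Finset.sum_range_one _).symm)
    exact hLength_tensor_le hS hN (LinearMap.range (X.d 0)).subtype_injective X.aug_surjective
      X.exact_subtype_aug 0
  | succ q ih =>
    refine ih.trans ?_
    rw [Finset.sum_range_succ _ (q + 1), add_assoc]
    gcongr
    exact hLength_tensor_le hS hN (LinearMap.range (X.d (q + 1))).subtype_injective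
      (X.d q).surjective_rangeRestrict (X.exact_subtype_rangeRestrict q) (q + 1)

/-- For `p = q + 1` the range of `d q` is projective, hence a retract of `R^(rank p)`. The remainder
left by `hLength_tensor_le_sum_add` is therefore at most the last summand. -/
lemma hLength_tensor_le_sum {S : Finset R}
    (hS : Ideal.span (S : Set R) = IsLocalRing.maximalIdeal R)
    (hN : ∀ f ∈ S, PowFactorsThroughFree f N) (p : ℕ)
    [h : CategoryTheory.HasProjectiveDimensionLE (ModuleCat.of R M) p] :
    hLength R 0 (M ⊗[R] N) ≤ ∑ i ∈ Finset.range (p + 1), (X.rank i : ℕ∞) * hLength R i N := by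
  cases p with
  | zero =>
    have : Module.Projective R M := (IsProjective.iff_projective M).2
      ((CategoryTheory.projective_iff_hasProjectiveDimensionLT_one).2 h)
    rw [zero_add, Finset.sum_range_one]
    exact hLength_tensor_le_of_projective X.aug_surjective 0
  | succ q =>
    have : CategoryTheory.HasProjectiveDimensionLT (ModuleCat.of R M) (q + 0 + 2) := h
    have : Module.Projective R (LinearMap.range (X.d q)) := (IsProjective.iff_projective _).2
      ((CategoryTheory.projective_iff_hasProjectiveDimensionLT_one).2
        (X.hasProjectiveDimensionLT_range q 0))
    refine (X.hLength_tensor_le_sum_add hS hN q).trans ?_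
    rw [Finset.sum_range_succ _ (q + 1)]
    gcongr
    exact hLength_tensor_le_of_projective (X.d q).surjective_rangeRestrict (q + 1)

end MinimalFreeResolution

end Resolution

theorem mainTheorem10 (R : Type u) [CommRing R] [IsLocalRing R] [IsNoetherianRing R]
    (hequi : IsEquidimensional R) (hgcm : IsGeneralizedCohenMacaulay R)
    (M N : Type u) [AddCommGroup M] [Module R M] [Module.Finite R M]
    [AddCommGroup N] [Module R N] [Module.Finite R N]
    (hN : IsLocallyFreeOfConstantRankOnPunctured R N)
    (hpd : CategoryTheory.projectiveDimension (ModuleCat.of R M) <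
      (localDepth R : WithBot ℕ∞)) :
    let p : ℕ := ((CategoryTheory.projectiveDimension (ModuleCat.of R M)).unbotD 0).toNat
    (∀ i ∈ Finset.range (p + 1), hLength R i N ≠ ⊤) ∧
    hLength R 0 (M ⊗[R] N) ≠ ⊤ ∧
    hLength R 0 (M ⊗[R] N) ≤
      ∑ i ∈ Finset.range (p + 1), (bettiNumber R i M : ℕ∞) * hLength R i N := by
  intro p
  obtain ⟨S, hS⟩ : (IsLocalRing.maximalIdeal R).FG := IsNoetherian.noetherian _
  have hP : ∀ f ∈ S, PowFactorsThroughFree f N := fun f hf =>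
    powFactorsThroughFree_of_isLocallyFree hN (hS ▸ Ideal.subset_span hf)
  -- The alternative `p = 0` covers projective dimension `⊥`, where `p` is a default value and the
  -- depth may be 0. Only `h^0(N)` then has to be finite, and this needs no depth bound.
  have hp : (CategoryTheory.projectiveDimension (ModuleCat.of R M) ≤ (p : WithBot ℕ∞)) ∧
      (p = 0 ∨ (p : ℕ∞) < localDepth R) := by
    generalize hd : CategoryTheory.projectiveDimension (ModuleCat.of R M) = d at *
    induction d using WithBot.recBotCoe with
    | bot => exact ⟨bot_le, Or.inl (by simp [p, hd])⟩
    | coe d =>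
      have hlt : d < localDepth R := WithBot.coe_lt_coe.1 hpd
      have hpeq : (p : ℕ∞) = d := by
        simp [p, hd, ENat.natCast_toNat hlt.ne_top]
      refine ⟨?_, Or.inr (hpeq ▸ hlt)⟩
      rw [← hpeq]
      rfl
  refine ⟨fun i hi => ?_, hLength_zero_ne_top R _, ?_⟩
  · rcases hp.2 with h0 | h0
    · have : i = 0 := by rw [h0] at hi; simpa using hi
      subst this
      exact hLength_zero_ne_top R N
    · refine hLength_ne_top_of_lt_localDepth hS i (lt_of_le_of_lt ?_ h0) N hP
      exact_mod_cast Nat.le_of_lt_succ (Finset.mem_range.1 hi)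
  · have : CategoryTheory.HasProjectiveDimensionLE (ModuleCat.of R M) p :=
      (CategoryTheory.projectiveDimension_le_iff _ _).1 hp.1
    exact (Classical.choice (MinimalFreeResolution.nonempty R M)).hLength_tensor_le_sum hS hP p
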